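/- Let $(\Omega,\mathcal F,\mathbb P)$ be a probability space, let $\theta:\Omega\to\Omega$ be an invertible (with measurable inverse), measure-preserving, ergodic transformation, let $\mathbb M_d$ be the algebra of complex $d\times d$ matrices, and let $\phi:\omega\mapsto\phi_\omega$ be a random quantum channel, i.e. a measurable map from $\Omega$ to the completely positive, trace-preserving linear maps $\mathbb M_d\to\mathbb M_d$. Put $\phi_{n;\omega}=\phi_{\theta^n(\omega)}$, $\Phi_N=\phi_N\circ\cdots\circ\phi_1$ for $N\ge 1$, and, for a random matrix $X:\Omega\to\mathbb M_d$, let $\mathfrak L(X)_\omega=\phi_\omega(X_{\theta^{-1}(\omega)})$ (the transfer operator). Inequalities between matrices are in the sense of the positive semidefinite order, and random matrices that agree almost surely are identified. A random projection is a random matrix $P$ with $P=P^*=P^2$ almost surely. It is called reducing if there is a (possibly random) constant $C>0$ such that, for every $N\ge 1$, $\Phi_N(P)\le C\,(P\circ\theta^N)$ almost surely. A minimal reducing projection is a minimal element, with respect to almost sure inequality, of the set of those reducing random projections $P$ that are nonzero, i.e. satisfy $\mathbb P(P\ne 0)>0$. Let $\mathfrak A_*$ be the space of random matrices $X$ with $\mathbb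 E\,\mathrm{Tr}|X|<\infty$, and, for a random projection $P$, let $P\mathfrak A_*P$ be the set of $X\in\mathfrak A_*$ with $PXP=X$ almost surely. Let $P$ be a minimal reducing projection, and let $X\in P\mathfrak A_*P$ satisfy $X=X^*$ and $\mathfrak L(X)=X$ almost surely. Then either $\mathbb P(X\ge 0)=1$ or $\mathbb P(-X\ge 0)=1$. -/

import Mathlib

open MeasureTheory
open scoped ComplexOrder MatrixOrder Matrix.Norms.L2Operator CStarAlgebra

noncomputable section

namespace ERIS

/-- The C*-algebra of complex `d × d` matrices. Its order is the Loewner order: `A ≤ B` means that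
`B - A` is positive semidefinite. -/
abbrev Mat (d : ℕ) : Type := Matrix (Fin d) (Fin d) ℂ

/-- The trace norm `Tr |A|`, where `|A| = √(A* A)`. -/
def traceNorm {d : ℕ} (A : Mat d) : ℝ := (Matrix.trace (CFC.abs A)).re

/-- A quantum channel: a completely positive and trace-preserving linear map. -/
structure QuantumChannel (d : ℕ) extends Mat d →CP Mat d where
  trace_map' : ∀ A : Mat d, Matrix.trace (toLinearMap A) = Matrix.trace A

instance (d : ℕ) : CoeFun (QuantumChannel d) (fun _ => Mat d → Mat d) :=
  ⟨fun ψ => ψ.toLinearMap⟩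

variable {Ω : Type*} [MeasurableSpace Ω] {d : ℕ}

/-- A random matrix: measurability is measurability of all entries. -/
def IsRandomMatrix (X : Ω → Mat d) : Prop :=
  ∀ i j, Measurable fun ω => X ω i j

/-- A random quantum channel: `ω ↦ φ_ω(A)` is measurable for every fixed matrix `A`, that is, all
matrix coefficients of `φ` are measurable. -/
def IsRandomChannel (φ : Ω → QuantumChannel d) : Prop :=
  ∀ A : Mat d, IsRandomMatrix fun ω => φ ω A

/-- A random projection: `P = P* = P²` almost surely. -/
def IsRandomProjection (μ : Measure Ω) (P : Ω → Mat d) : Prop :=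
  IsRandomMatrix P ∧ ∀ᵐ ω ∂μ, IsStarProjection (P ω)

/-- For `N ≥ 1` and `φ_{n;ω} = φ_{θⁿ ω}`, this is `Φ_{N;ω} = φ_{N;ω} ∘ ⋯ ∘ φ_{1;ω}`
(the empty composition for `N = 0`). -/
def forward (θ : Ω ≃ᵐ Ω) (φ : Ω → QuantumChannel d) : ℕ → Ω → Mat d → Mat d
  | 0, _, A => A
  | N + 1, ω, A => φ (θ^[N + 1] ω) (forward θ φ N ω A)

/-- The transfer operator `𝔏(X)_ω = φ_ω(X_{θ⁻¹ ω})`. -/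
def transfer (θ : Ω ≃ᵐ Ω) (φ : Ω → QuantumChannel d) (X : Ω → Mat d) : Ω → Mat d :=
  fun ω => φ ω (X (θ.symm ω))

/-- The random projection `P` reduces the system: for some random constant `C > 0` and all
`N ≥ 1`, `Φ_N(P) ≤ C (P ∘ θ^N)` almost surely. -/
def Reduces (μ : Measure Ω) (θ : Ω ≃ᵐ Ω) (φ : Ω → QuantumChannel d) (P : Ω → Mat d) : Prop :=
  ∃ C : Ω → ℝ, Measurable C ∧ (∀ᵐ ω ∂μ, 0 < C ω) ∧
    ∀ N : ℕ, 1 ≤ N → ∀ᵐ ω ∂μ, forward θ φ N ω (P ω) ≤ C ω • P (θ^[N] ω)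

/-- The nonzero reducing random projections; nonzero means nonzero with positive probability. -/
def IsNonzeroReducing (μ : Measure Ω) (θ : Ω ≃ᵐ Ω) (φ : Ω → QuantumChannel d)
    (P : Ω → Mat d) : Prop :=
  IsRandomProjection μ P ∧ Reduces μ θ φ P ∧ ¬ ∀ᵐ ω ∂μ, P ω = 0

/-- Minimal elements of the set of nonzero reducing random projections, ordered by almost sure
inequality; random matrices are identified when they agree almost surely. -/
def IsMinimalReducing (μ : Measure Ω) (θ : Ω ≃ᵐ Ω) (φ : Ω → QuantumChannel d)
    (P : Ω → Mat d) : Prop :=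
  IsNonzeroReducing μ θ φ P ∧
    ∀ Q : Ω → Mat d, IsNonzeroReducing μ θ φ Q → (∀ᵐ ω ∂μ, Q ω ≤ P ω) → ∀ᵐ ω ∂μ, Q ω = P ω

/-- Membership in `𝔄_*`: random matrices whose trace norm is integrable. -/
def MemPredual (μ : Measure Ω) (X : Ω → Mat d) : Prop :=
  IsRandomMatrix X ∧ Integrable (fun ω => traceNorm (X ω)) μ

/-- Membership in the corner `P 𝔄_* P`: elements `X` of `𝔄_*` with `P X P = X` almost surely. -/
def MemCornerPredual (μ : Measure Ω) (P X : Ω → Mat d) : Prop :=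
  MemPredual μ X ∧ ∀ᵐ ω ∂μ, P ω * X ω * P ω = X ω

end ERIS

end

/-!
Write the fixed point as `X = X⁺ - X⁻`, so that `X = φ(X⁺ ∘ θ⁻¹) - φ(X⁻ ∘ θ⁻¹)` is a difference of
nonnegative matrices. The positive part of `B - D` with `B, D ≥ 0` has trace at most `Tr B`, with
equality only if it is `B`. Hence `Tr X⁺ ≤ Tr X⁺ ∘ θ⁻¹` pointwise; since both sides have the same
finite integral, equality holds almost surely and `X⁺`, hence also `X⁻`, is a fixed point.

The support projection of a nonnegative fixed point `Y` is reducing: it is comparable with `Y`, and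
`Φ_N(Y) = Y ∘ θ^N`. By minimality the supports of `X⁺` and `X⁻`, which lie below `P`, are each `0`
or `P`; being orthogonal, they cannot both be `P`.
-/

namespace ERIS

theorem negPart_eq_posPart_sub {A : Type*} [NonUnitalRing A] [Module ℝ A] [SMulCommClass ℝ A A]
    [IsScalarTower ℝ A A] [StarRing A] [TopologicalSpace A]
    [NonUnitalContinuousFunctionalCalculus ℝ A IsSelfAdjoint] {a : A} (ha : IsSelfAdjoint a) :
    a⁻ = a⁺ - a :=
  eq_sub_of_add_eq' (sub_eq_iff_eq_add.1 (CFC.posPart_sub_negPart a ha)).symm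

section Matrix

variable {n 𝕜 : Type*} [Fintype n] [RCLike 𝕜] {A B D P : Matrix n n 𝕜}

theorem re_trace_nonneg (hA : 0 ≤ A) : 0 ≤ RCLike.re A.trace :=
  (RCLike.nonneg_iff.1 (Matrix.nonneg_iff_posSemidef.1 hA).trace_nonneg).1

theorem re_trace_mono (h : A ≤ B) : RCLike.re A.trace ≤ RCLike.re B.trace := by
  rw [← sub_nonneg, ← map_sub, ← Matrix.trace_sub]
  exact re_trace_nonneg (sub_nonneg.2 h)

theorem trace_mul_nonneg (hA : 0 ≤ A) (hB : 0 ≤ B) : 0 ≤ (A * B).trace := by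
  classical
  obtain ⟨S, rfl⟩ := CStarAlgebra.nonneg_iff_eq_star_mul_self.1 hA
  rw [mul_assoc, Matrix.trace_mul_comm]
  exact ((Matrix.nonneg_iff_posSemidef.1 hB).mul_mul_conjTranspose_same S).trace_nonneg

theorem trace_mul_eq_zero_iff (hA : 0 ≤ A) (hB : 0 ≤ B) : (A * B).trace = 0 ↔ A * B = 0 := by
  classical
  refine ⟨fun h => ?_, fun h => by rw [h, Matrix.trace_zero]⟩
  obtain ⟨S, rfl⟩ := CStarAlgebra.nonneg_iff_eq_star_mul_self.1 hA
  obtain ⟨T, rfl⟩ := CStarAlgebra.nonneg_iff_eq_star_mul_self.1 hB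
  have hST : S * star T = 0 := by
    rw [← Matrix.trace_mul_conjTranspose_self_eq_zero_iff, ← Matrix.star_eq_conjTranspose, ← h,
      mul_assoc (star S), Matrix.trace_mul_comm (star S)]
    simp only [star_mul, star_star, mul_assoc]
  rw [mul_assoc, ← mul_assoc S, hST, zero_mul, mul_zero]

variable [DecidableEq n]

theorem continuousOn_spectrum (f : ℝ → ℝ) (A : Matrix n n 𝕜) : ContinuousOn f (spectrum ℝ A) :=
  Matrix.finite_real_spectrum.continuousOn f

theorem le_re_trace_of_mem_spectrum (hA : 0 ≤ A) {x : ℝ} (hx : x ∈ spectrum ℝ A) :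
    x ≤ RCLike.re A.trace := by
  have hpsd : A.PosSemidef := Matrix.nonneg_iff_posSemidef.1 hA
  obtain ⟨i, rfl⟩ := hpsd.isHermitian.spectrum_real_eq_range_eigenvalues ▸ hx
  rw [hpsd.isHermitian.trace_eq_sum_eigenvalues, ← RCLike.ofReal_sum, RCLike.ofReal_re]
  exact Finset.single_le_sum (f := hpsd.isHermitian.eigenvalues)
    (fun j _ => hpsd.eigenvalues_nonneg j) (Finset.mem_univ i)

/-- The orthogonal projection onto the range of a Hermitian matrix, and `0` if the matrix is not
Hermitian. Since `0⁻¹ = 0`, the function `x * x⁻¹` is the indicator of `x ≠ 0`. -/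
noncomputable def supportProj (A : Matrix n n 𝕜) : Matrix n n 𝕜 :=
  cfc (fun x : ℝ => x * x⁻¹) A

theorem isStarProjection_supportProj (A : Matrix n n 𝕜) : IsStarProjection (supportProj A) := by
  refine ⟨?_, cfc_predicate _ A⟩
  rw [IsIdempotentElem, supportProj,
    ← cfc_mul _ _ A (continuousOn_spectrum _ _) (continuousOn_spectrum _ _)]
  congr 1
  ext x
  rw [← mul_assoc, mul_inv_mul_cancel]

theorem supportProj_eq_mul_cfc_inv (hA : IsSelfAdjoint A) :
    supportProj A = A * cfc (fun x : ℝ => x⁻¹) A := by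
  rw [supportProj, cfc_mul _ _ A (continuousOn_spectrum _ _) (continuousOn_spectrum _ _),
    cfc_id' ℝ A]

theorem supportProj_eq_cfc_inv_mul (hA : IsSelfAdjoint A) :
    supportProj A = cfc (fun x : ℝ => x⁻¹) A * A := by
  rw [supportProj_eq_mul_cfc_inv hA, (Commute.refl A).cfc_real _ |>.eq]

theorem mul_supportProj_self (hA : IsSelfAdjoint A) : A * supportProj A = A := by
  nth_rw 1 3 [← cfc_id' ℝ A]
  rw [supportProj, ← cfc_mul _ _ A (continuousOn_spectrum _ _) (continuousOn_spectrum _ _)]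
  congr 1
  ext x
  rw [← mul_assoc, mul_self_mul_inv]

theorem mul_supportProj_eq_self (hA : IsSelfAdjoint A) (h : P * A = A) :
    P * supportProj A = supportProj A := by
  rw [supportProj_eq_mul_cfc_inv hA, ← mul_assoc, h]

theorem mul_supportProj_eq_zero (hB : IsSelfAdjoint B) (h : A * B = 0) :
    A * supportProj B = 0 := by
  rw [supportProj_eq_mul_cfc_inv hB, ← mul_assoc, h, zero_mul]

theorem supportProj_mul_supportProj_eq_zero (hA : IsSelfAdjoint A) (hB : IsSelfAdjoint B)
    (h : A * B = 0) : supportProj A * supportProj B = 0 := by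
  rw [supportProj_eq_cfc_inv_mul hA, mul_assoc, mul_supportProj_eq_zero hB h, mul_zero]

theorem supportProj_eq_zero_iff (hA : IsSelfAdjoint A) : supportProj A = 0 ↔ A = 0 := by
  refine ⟨fun h => ?_, fun h => by rw [supportProj_eq_mul_cfc_inv hA, h, zero_mul]⟩
  rw [← mul_supportProj_self hA, h, mul_zero]

theorem le_re_trace_smul_supportProj (hA : 0 ≤ A) : A ≤ RCLike.re A.trace • supportProj A := by
  nth_rw 1 [← cfc_id' ℝ A]
  rw [supportProj, ← cfc_smul _ _ A (continuousOn_spectrum _ _)]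
  refine cfc_mono (fun x hx => ?_) (continuousOn_spectrum _ _) (continuousOn_spectrum _ _)
  have hx0 : 0 ≤ x := spectrum_nonneg_of_nonneg hA hx
  calc x = x * (x * x⁻¹) := by rw [← mul_assoc, mul_self_mul_inv]
    _ ≤ RCLike.re A.trace * (x * x⁻¹) :=
      mul_le_mul_of_nonneg_right (le_re_trace_of_mem_spectrum hA hx) (by positivity)

theorem supportProj_le_re_trace_cfc_inv_smul (hA : 0 ≤ A) :
    supportProj A ≤ RCLike.re (cfc (fun x : ℝ => x⁻¹) A).trace • A := by
  have hspec : ∀ x ∈ spectrum ℝ A, 0 ≤ x := fun _ hx => spectrum_nonneg_of_nonneg hA hx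
  have hinv : 0 ≤ cfc (fun x : ℝ => x⁻¹) A := cfc_nonneg fun x hx => inv_nonneg.2 (hspec x hx)
  rw [← cfc_const_mul_id _ A, supportProj]
  refine cfc_mono (fun x hx => ?_) (continuousOn_spectrum _ _) (continuousOn_spectrum _ _)
  have hx_inv : x⁻¹ ∈ spectrum ℝ (cfc (fun x : ℝ => x⁻¹) A) := by
    rw [cfc_map_spectrum _ A (.of_nonneg hA) (continuousOn_spectrum _ _)]
    exact Set.mem_image_of_mem _ hx
  rw [mul_comm x]
  exact mul_le_mul_of_nonneg_right (le_re_trace_of_mem_spectrum hinv hx_inv) (hspec x hx)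

theorem mul_supportProj_posPart (hA : IsSelfAdjoint A) : A * supportProj A⁺ = A⁺ := by
  have hpos : IsSelfAdjoint A⁺ := IsSelfAdjoint.of_nonneg (CFC.posPart_nonneg A)
  nth_rw 1 [← CFC.posPart_sub_negPart A hA]
  rw [sub_mul, mul_supportProj_self hpos,
    mul_supportProj_eq_zero hpos (CFC.negPart_mul_posPart A), sub_zero]

theorem mul_posPart_eq_self (hA : IsSelfAdjoint A) (h : P * A = A) : P * A⁺ = A⁺ := by
  rw [← mul_supportProj_posPart hA, ← mul_assoc, h]

theorem mul_negPart_eq_self (hA : IsSelfAdjoint A) (h : P * A = A) : P * A⁻ = A⁻ := by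
  rw [negPart_eq_posPart_sub hA, mul_sub, mul_posPart_eq_self hA h, h]

theorem trace_sub_trace_posPart_sub (hB : IsSelfAdjoint B) (hD : IsSelfAdjoint D) :
    B.trace - (B - D)⁺.trace =
      (B * (1 - supportProj (B - D)⁺)).trace + (D * supportProj (B - D)⁺).trace := by
  nth_rw 1 [← mul_supportProj_posPart (hB.sub hD)]
  simp only [mul_sub, sub_mul, mul_one, Matrix.trace_sub]
  ring

theorem trace_posPart_sub_le (hB : 0 ≤ B) (hD : 0 ≤ D) : (B - D)⁺.trace ≤ B.trace := by
  rw [← sub_nonneg, trace_sub_trace_posPart_sub (.of_nonneg hB) (.of_nonneg hD)]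
  have hQ := isStarProjection_supportProj (B - D)⁺
  exact add_nonneg (trace_mul_nonneg hB hQ.one_sub.nonneg) (trace_mul_nonneg hD hQ.nonneg)

theorem posPart_sub_eq_of_trace_eq (hB : 0 ≤ B) (hD : 0 ≤ D)
    (h : (B - D)⁺.trace = B.trace) : (B - D)⁺ = B := by
  have hQ := isStarProjection_supportProj (B - D)⁺
  have hsum := trace_sub_trace_posPart_sub (.of_nonneg hB) (.of_nonneg hD)
  rw [h, sub_self, eq_comm, add_eq_zero_iff_of_nonneg (trace_mul_nonneg hB hQ.one_sub.nonneg)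
    (trace_mul_nonneg hD hQ.nonneg), trace_mul_eq_zero_iff hB hQ.one_sub.nonneg,
    trace_mul_eq_zero_iff hD hQ.nonneg, mul_sub, mul_one, sub_eq_zero] at hsum
  obtain ⟨hBQ, hDQ⟩ := hsum
  rw [← mul_supportProj_posPart ((IsSelfAdjoint.of_nonneg hB).sub (.of_nonneg hD)), sub_mul,
    ← hBQ, hDQ, sub_zero]

end Matrix

section Measurability

variable {n : Type*}

noncomputable instance : MeasurableSpace (Matrix n n ℂ) :=
  inferInstanceAs (MeasurableSpace (n → n → ℂ))

instance [Finite n] : BorelSpace (Matrix n n ℂ) := inferInstanceAs (BorelSpace (n → n → ℂ))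

variable [Fintype n]

theorem measurable_re_trace : Measurable fun A : Matrix n n ℂ => A.trace.re :=
  (by fun_prop : Continuous fun A : Matrix n n ℂ => A.trace.re).measurable

variable [DecidableEq n]

theorem measurable_cfc_of_continuous {f : ℝ → ℝ} (hf : Continuous f) :
    Measurable (cfc f : Matrix n n ℂ → Matrix n n ℂ) := by
  classical
  have hclosed : IsClosed {A : Matrix n n ℂ | IsSelfAdjoint A} :=
    isClosed_eq continuous_star continuous_id
  have hcont : ContinuousOn (cfc f) {A : Matrix n n ℂ | IsSelfAdjoint A} :=
    continuousOn_id.cfc_of_mem_nhdsSet f Filter.univ_mem (fun _ h => h) hf.continuousOn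
  have hpiecewise : cfc f = {A : Matrix n n ℂ | IsSelfAdjoint A}.piecewise (cfc f) fun _ => 0 := by
    funext A
    by_cases hA : IsSelfAdjoint A
    · simp [hA]
    · simp [hA, cfc_apply_of_not_predicate]
  rw [hpiecewise]
  exact hcont.measurable_piecewise continuousOn_const hclosed.measurableSet

-- Since the spectrum of a matrix is finite, pointwise convergence is uniform on it.
theorem measurable_cfc_of_tendsto {f : ℝ → ℝ} {F : ℕ → ℝ → ℝ} (hF : ∀ k, Continuous (F k))
    (hlim : ∀ x, Filter.Tendsto (fun k => F k x) Filter.atTop (nhds (f x))) :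
    Measurable (cfc f : Matrix n n ℂ → Matrix n n ℂ) := by
  refine measurable_of_tendsto_metrizable (fun k => measurable_cfc_of_continuous (hF k))
    (tendsto_pi_nhds.2 fun A => ?_)
  refine tendsto_cfc_fun ?_ (.of_forall fun k => (hF k).continuousOn)
  rw [Metric.tendstoUniformlyOn_iff]
  intro ε hε
  refine (Matrix.finite_real_spectrum (A := A)).eventually_all.2 fun x _ => ?_
  simpa only [dist_comm] using Metric.tendsto_nhds.1 (hlim x) ε hε

theorem tendsto_div_sq_add_inv (x : ℝ) :
    Filter.Tendsto (fun k : ℕ => x / (x ^ 2 + 1 / ((k : ℝ) + 1))) Filter.atTop (nhds x⁻¹) := by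
  rcases eq_or_ne x 0 with rfl | hx
  · simp
  · have h := (tendsto_const_nhds (x := x)).div
      (tendsto_one_div_add_atTop_nhds_zero_nat.const_add (x ^ 2)) (by simpa using hx)
    have hlim : x / (x ^ 2 + 0) = x⁻¹ := by rw [add_zero, sq, div_mul_cancel_left₀ hx]
    rwa [hlim] at h

theorem continuous_div_sq_add {ε : ℝ} (hε : 0 < ε) : Continuous fun x : ℝ => x / (x ^ 2 + ε) :=
  continuous_id.div (by fun_prop) fun _ => by positivity

theorem measurable_cfc_inv : Measurable (cfc (fun x : ℝ => x⁻¹) : Matrix n n ℂ → Matrix n n ℂ) :=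
  measurable_cfc_of_tendsto (fun _ => continuous_div_sq_add (by positivity))
    tendsto_div_sq_add_inv

theorem measurable_supportProj : Measurable (supportProj : Matrix n n ℂ → Matrix n n ℂ) :=
  measurable_cfc_of_tendsto
    (fun _ => continuous_id.mul (continuous_div_sq_add (by positivity)))
    fun x => (tendsto_div_sq_add_inv x).const_mul x

theorem measurable_posPart : Measurable fun A : Matrix n n ℂ => A⁺ := by
  have hcont : Continuous fun x : ℝ => x⁺ := continuous_id.sup continuous_const
  simpa only [CFC.posPart_def, cfcₙ_eq_cfc hcont.continuousOn posPart_zero] using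
    measurable_cfc_of_continuous (n := n) hcont

theorem measurable_negPart : Measurable fun A : Matrix n n ℂ => A⁻ := by
  simp only [← CFC.posPart_neg]
  exact measurable_posPart.comp continuous_neg.measurable

end Measurability

theorem ae_eq_comp_of_ae_le_comp {α : Type*} [MeasurableSpace α] {ν : Measure α} {T : α → α}
    (hT : MeasurePreserving T ν ν) {f : α → ℝ} (hf : Integrable f ν) (hle : f ≤ᵐ[ν] f ∘ T) :
    f =ᵐ[ν] f ∘ T := by
  have hint : ∫ x, f x ∂ν = ∫ x, f (T x) ∂ν := by
    conv_lhs => rw [← hT.map_eq]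
    exact integral_map hT.aemeasurable (hT.map_eq.symm ▸ hf.aestronglyMeasurable)
  exact (integral_eq_iff_of_ae_le hf (hT.integrable_comp_of_integrable hf) hle).1 hint

section Dynamics

variable {Ω : Type*} [MeasurableSpace Ω] {μ : Measure Ω} {d : ℕ} {θ : Ω ≃ᵐ Ω}
  {φ : Ω → QuantumChannel d} {P X : Ω → Mat d}

theorem isRandomMatrix_iff_measurable : IsRandomMatrix X ↔ Measurable X := by
  refine Iff.trans ?_ measurable_pi_iff.symm
  exact forall_congr' fun i => measurable_pi_iff.symm

theorem re_trace_posPart_le_traceNorm {A : Mat d} (hA : IsSelfAdjoint A) :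
    A⁺.trace.re ≤ traceNorm A := by
  refine re_trace_mono (𝕜 := ℂ) ?_
  rw [← CFC.posPart_add_negPart A hA]
  exact le_add_of_nonneg_right (CFC.negPart_nonneg A)

theorem QuantumChannel.mono (ψ : QuantumChannel d) {A B : Mat d} (h : A ≤ B) : ψ A ≤ ψ B :=
  OrderHomClass.mono ψ.toCompletelyPositiveMap h

theorem QuantumChannel.nonneg (ψ : QuantumChannel d) {A : Mat d} (hA : 0 ≤ A) : 0 ≤ ψ A := by
  simpa only [map_zero] using ψ.mono hA

theorem forward_mono (N : ℕ) (ω : Ω) {A B : Mat d} (h : A ≤ B) :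
    forward θ φ N ω A ≤ forward θ φ N ω B := by
  induction N with
  | zero => exact h
  | succ N ih => exact (φ _).mono ih

theorem forward_smul (N : ℕ) (ω : Ω) (c : ℝ) (A : Mat d) :
    forward θ φ N ω (c • A) = c • forward θ φ N ω A := by
  induction N with
  | zero => rfl
  | succ N ih => simp only [forward, ih, LinearMap.map_smul_of_tower]

theorem trace_forward (N : ℕ) (ω : Ω) (A : Mat d) : (forward θ φ N ω A).trace = A.trace := by
  induction N with
  | zero => rfl
  | succ N ih => rw [forward, (φ _).trace_map', ih]

theorem forward_eq_of_transfer_eq (hθ : MeasurePreserving θ μ μ)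
    (hfix : ∀ᵐ ω ∂μ, transfer θ φ X ω = X ω) :
    ∀ᵐ ω ∂μ, ∀ N : ℕ, forward θ φ N ω (X ω) = X (θ^[N] ω) := by
  have horbit : ∀ᵐ ω ∂μ, ∀ N : ℕ, transfer θ φ X (θ^[N] ω) = X (θ^[N] ω) :=
    ae_all_iff.2 fun N => (hθ.iterate N).quasiMeasurePreserving.ae hfix
  filter_upwards [horbit] with ω hω N
  induction N with
  | zero => rfl
  | succ N ih =>
    rw [forward, ih, ← hω (N + 1), transfer, Function.iterate_succ_apply', θ.symm_apply_apply]

theorem transfer_sub (X Y : Ω → Mat d) (ω : Ω) :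
    transfer θ φ (fun ω => X ω - Y ω) ω = transfer θ φ X ω - transfer θ φ Y ω :=
  map_sub _ _ _

theorem integrable_re_trace_posPart (hX : MemPredual μ X) (hsa : ∀ᵐ ω ∂μ, IsSelfAdjoint (X ω)) :
    Integrable (fun ω => (X ω)⁺.trace.re) μ := by
  have hmeas : Measurable fun ω => (X ω)⁺.trace.re :=
    measurable_re_trace.comp (measurable_posPart.comp (isRandomMatrix_iff_measurable.1 hX.1))
  refine hX.2.mono' hmeas.aestronglyMeasurable ?_
  filter_upwards [hsa] with ω hω
  have hnonneg : 0 ≤ (X ω)⁺.trace.re :=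
    re_trace_nonneg (𝕜 := ℂ) (CFC.posPart_nonneg _)
  rw [Real.norm_of_nonneg hnonneg]
  exact re_trace_posPart_le_traceNorm hω

theorem transfer_posPart_eq (hθ : MeasurePreserving θ μ μ) (hX : MemPredual μ X)
    (hsa : ∀ᵐ ω ∂μ, IsSelfAdjoint (X ω)) (hfix : ∀ᵐ ω ∂μ, transfer θ φ X ω = X ω) :
    ∀ᵐ ω ∂μ, transfer θ φ (fun ω => (X ω)⁺) ω = (X ω)⁺ := by
  have hθ_symm : MeasurePreserving θ.symm μ μ := hθ.symm θ
  have hB ω : 0 ≤ transfer θ φ (fun ω => (X ω)⁺) ω := (φ ω).nonneg (CFC.posPart_nonneg _)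
  have hD ω : 0 ≤ transfer θ φ (fun ω => (X ω)⁻) ω := (φ ω).nonneg (CFC.negPart_nonneg _)
  have hdecomp : ∀ᵐ ω ∂μ, transfer θ φ (fun ω => (X ω)⁺) ω - transfer θ φ (fun ω => (X ω)⁻) ω =
      X ω := by
    filter_upwards [hfix, hθ_symm.quasiMeasurePreserving.ae hsa] with ω hω hsaω
    rw [← transfer_sub, ← hω, transfer, CFC.posPart_sub_negPart _ hsaω, transfer]
  have htrace ω : (transfer θ φ (fun ω => (X ω)⁺) ω).trace = (X (θ.symm ω))⁺.trace :=
    (φ ω).trace_map' _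
  have hle : ∀ᵐ ω ∂μ, (X ω)⁺.trace ≤ (X (θ.symm ω))⁺.trace := by
    filter_upwards [hdecomp] with ω hω
    rw [← htrace, ← hω]
    exact trace_posPart_sub_le (hB ω) (hD ω)
  have hre := ae_eq_comp_of_ae_le_comp hθ_symm (integrable_re_trace_posPart hX hsa)
    (hle.mono fun ω h => (Complex.le_def.1 h).1)
  filter_upwards [hdecomp, hle, hre] with ω hω hleω hreω
  have htr : (X ω)⁺.trace = (X (θ.symm ω))⁺.trace :=
    Complex.ext hreω (Complex.le_def.1 hleω).2
  rw [← htrace, ← hω] at htr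
  rw [← hω, posPart_sub_eq_of_trace_eq (hB ω) (hD ω) htr]

theorem transfer_negPart_eq (hθ : MeasurePreserving θ μ μ) (hX : MemPredual μ X)
    (hsa : ∀ᵐ ω ∂μ, IsSelfAdjoint (X ω)) (hfix : ∀ᵐ ω ∂μ, transfer θ φ X ω = X ω) :
    ∀ᵐ ω ∂μ, transfer θ φ (fun ω => (X ω)⁻) ω = (X ω)⁻ := by
  filter_upwards [transfer_posPart_eq hθ hX hsa hfix, hfix, hsa,
    (hθ.symm θ).quasiMeasurePreserving.ae hsa] with ω hpos hω hsaω hsaω'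
  rw [negPart_eq_posPart_sub hsaω, ← hpos, ← hω, ← transfer_sub, transfer,
    negPart_eq_posPart_sub hsaω', transfer]

theorem reduces_supportProj (hθ : MeasurePreserving θ μ μ) (hX : IsRandomMatrix X)
    (hnonneg : ∀ᵐ ω ∂μ, 0 ≤ X ω) (hfix : ∀ᵐ ω ∂μ, transfer θ φ X ω = X ω) :
    Reduces μ θ φ fun ω => supportProj (X ω) := by
  have hXm := isRandomMatrix_iff_measurable.1 hX
  let c ω := (cfc (fun x : ℝ => x⁻¹) (X ω)).trace.re
  have hc : ∀ᵐ ω ∂μ, 0 ≤ c ω := hnonneg.mono fun ω hω => re_trace_nonneg <|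
    cfc_nonneg fun x hx => inv_nonneg.2 (spectrum_nonneg_of_nonneg hω hx)
  -- The summand `1` only makes the constant positive where `X` vanishes.
  refine ⟨fun ω => c ω * (X ω).trace.re + 1, ?_, ?_, fun N _ => ?_⟩
  · exact ((measurable_re_trace.comp (measurable_cfc_inv.comp hXm)).mul
      (measurable_re_trace.comp hXm)).add_const 1
  · filter_upwards [hc, hnonneg] with ω hcω hω
    have := re_trace_nonneg hω
    positivity
  filter_upwards [hc, hnonneg, (hθ.iterate N).quasiMeasurePreserving.ae hnonneg,
    forward_eq_of_transfer_eq hθ hfix] with ω hcω hω hωN hfwd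
  have htr : (X (θ^[N] ω)).trace.re = (X ω).trace.re := by rw [← hfwd N, trace_forward]
  calc forward θ φ N ω (supportProj (X ω))
      ≤ forward θ φ N ω (c ω • X ω) :=
        forward_mono N ω (supportProj_le_re_trace_cfc_inv_smul hω)
    _ = c ω • X (θ^[N] ω) := by rw [forward_smul, hfwd N]
    _ ≤ c ω • ((X ω).trace.re • supportProj (X (θ^[N] ω))) :=
        smul_le_smul_of_nonneg_left (htr ▸ le_re_trace_smul_supportProj hωN) hcω
    _ = (c ω * (X ω).trace.re) • supportProj (X (θ^[N] ω)) := smul_smul _ _ _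
    _ ≤ (c ω * (X ω).trace.re + 1) • supportProj (X (θ^[N] ω)) :=
        smul_le_smul_of_nonneg_right (by linarith) (isStarProjection_supportProj _).nonneg

theorem IsMinimalReducing.eq_zero_or_supportProj_eq (hP : IsMinimalReducing μ θ φ P)
    (hθ : MeasurePreserving θ μ μ) (hX : IsRandomMatrix X) (hnonneg : ∀ᵐ ω ∂μ, 0 ≤ X ω)
    (hfix : ∀ᵐ ω ∂μ, transfer θ φ X ω = X ω) (hPX : ∀ᵐ ω ∂μ, P ω * X ω = X ω) :
    (∀ᵐ ω ∂μ, X ω = 0) ∨ ∀ᵐ ω ∂μ, supportProj (X ω) = P ω := by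
  refine or_iff_not_imp_left.2 fun hX_ne => hP.2 _ ⟨⟨?_, ?_⟩, ?_, fun hsupp => hX_ne ?_⟩ ?_
  · exact isRandomMatrix_iff_measurable.2
      (measurable_supportProj.comp (isRandomMatrix_iff_measurable.1 hX))
  · exact .of_forall fun ω => isStarProjection_supportProj _
  · exact reduces_supportProj hθ hX hnonneg hfix
  · filter_upwards [hnonneg, hsupp] with ω hω
    exact (supportProj_eq_zero_iff (.of_nonneg hω)).1
  · filter_upwards [hP.1.1.2, hPX, hnonneg] with ω hPω hPXω hω
    rw [(isStarProjection_supportProj _).le_iff_mul_eq_right hPω]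
    exact mul_supportProj_eq_self (.of_nonneg hω) hPXω

theorem IsMinimalReducing.posPart_eq_zero_or_negPart_eq_zero (hP : IsMinimalReducing μ θ φ P)
    (hθ : MeasurePreserving θ μ μ) (hX : MemCornerPredual μ P X)
    (hsa : ∀ᵐ ω ∂μ, IsSelfAdjoint (X ω)) (hfix : ∀ᵐ ω ∂μ, transfer θ φ X ω = X ω) :
    (∀ᵐ ω ∂μ, (X ω)⁺ = 0) ∨ ∀ᵐ ω ∂μ, (X ω)⁻ = 0 := by
  have hXm := isRandomMatrix_iff_measurable.1 hX.1.1
  have hPX : ∀ᵐ ω ∂μ, P ω * X ω = X ω := by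
    filter_upwards [hP.1.1.2, hX.2] with ω hPω hω
    rw [← hω, ← mul_assoc, ← mul_assoc, hPω.isIdempotentElem.eq]
  have hpos : (∀ᵐ ω ∂μ, (X ω)⁺ = 0) ∨ ∀ᵐ ω ∂μ, supportProj (X ω)⁺ = P ω :=
    hP.eq_zero_or_supportProj_eq hθ
      (isRandomMatrix_iff_measurable.2 (measurable_posPart.comp hXm))
      (.of_forall fun ω => CFC.posPart_nonneg (X ω)) (transfer_posPart_eq hθ hX.1 hsa hfix)
      (by filter_upwards [hsa, hPX] with ω hsaω using mul_posPart_eq_self hsaω)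
  have hneg : (∀ᵐ ω ∂μ, (X ω)⁻ = 0) ∨ ∀ᵐ ω ∂μ, supportProj (X ω)⁻ = P ω :=
    hP.eq_zero_or_supportProj_eq hθ
      (isRandomMatrix_iff_measurable.2 (measurable_negPart.comp hXm))
      (.of_forall fun ω => CFC.negPart_nonneg (X ω)) (transfer_negPart_eq hθ hX.1 hsa hfix)
      (by filter_upwards [hsa, hPX] with ω hsaω using mul_negPart_eq_self hsaω)
  refine hpos.imp_right fun hsupp_pos => hneg.resolve_right fun hsupp_neg => hP.1.2.2 ?_
  filter_upwards [hsupp_pos, hsupp_neg, hP.1.1.2] with ω hposω hnegω hPω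
  calc P ω = supportProj (X ω)⁺ * supportProj (X ω)⁻ := by
        rw [hposω, hnegω, hPω.isIdempotentElem.eq]
    _ = 0 := supportProj_mul_supportProj_eq_zero (.of_nonneg (CFC.posPart_nonneg _))
        (.of_nonneg (CFC.negPart_nonneg _)) (CFC.posPart_mul_negPart _)

end Dynamics

end ERIS

theorem mainTheorem5_general {Ω : Type*} [MeasurableSpace Ω] (μ : Measure Ω) (d : ℕ)
    (θ : Ω ≃ᵐ Ω) (hθ : MeasurePreserving θ μ μ) (φ : Ω → ERIS.QuantumChannel d)
    (P : Ω → ERIS.Mat d) (hP : ERIS.IsMinimalReducing μ θ φ P)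
    (X : Ω → ERIS.Mat d) (hX : ERIS.MemCornerPredual μ P X)
    (hsa : ∀ᵐ ω ∂μ, IsSelfAdjoint (X ω))
    (hfix : ∀ᵐ ω ∂μ, ERIS.transfer θ φ X ω = X ω) :
    (∀ᵐ ω ∂μ, 0 ≤ X ω) ∨ (∀ᵐ ω ∂μ, 0 ≤ -X ω) := by
  rcases hP.posPart_eq_zero_or_negPart_eq_zero hθ hX hsa hfix with hpos | hneg
  · right
    filter_upwards [hpos, hsa] with ω hω hsaω
    exact neg_nonneg.2 ((CFC.posPart_eq_zero_iff _ hsaω).1 hω)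
  · left
    filter_upwards [hneg, hsa] with ω hω hsaω
    exact (CFC.negPart_eq_zero_iff _ hsaω).1 hω

theorem mainTheorem5 {Ω : Type*} [MeasurableSpace Ω] (μ : Measure Ω) [IsProbabilityMeasure μ]
    (d : ℕ) (θ : Ω ≃ᵐ Ω) (hθ : Ergodic θ μ)
    (φ : Ω → ERIS.QuantumChannel d) (hφ : ERIS.IsRandomChannel φ)
    (P : Ω → ERIS.Mat d) (hP : ERIS.IsMinimalReducing μ θ φ P)
    (X : Ω → ERIS.Mat d) (hX : ERIS.MemCornerPredual μ P X)
    (hsa : ∀ᵐ ω ∂μ, IsSelfAdjoint (X ω))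
    (hfix : ∀ᵐ ω ∂μ, ERIS.transfer θ φ X ω = X ω) :
    (∀ᵐ ω ∂μ, 0 ≤ X ω) ∨ (∀ᵐ ω ∂μ, 0 ≤ -X ω) :=
  mainTheorem5_general μ d θ hθ.toMeasurePreserving φ P hP X hX hsa hfix
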